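/- Let $q$ be a prime power, let $\mathbf{F}_q$ be the field with $q$ elements, and for $j\ge 1$ let $N(q;j)$ be the number of monic irreducible polynomials of degree $j$ over $\mathbf{F}_q$ with non-zero constant term. Fix $q$ and $t\ge 1$. For each $n$ let $C_n$ be an arbitrary coset of $\mathrm{SL}_n(q)$ in $\mathrm{GL}_n(q)$. Then, as $n\to\infty$, the proportion of elements of $C_n$ whose characteristic polynomial has no irreducible factor over $\mathbf{F}_q$ of degree at most $t$ converges to $$\prod_{j=1}^t\ \prod_{i\ge 1}\left(1-\frac{1}{q^{ij}}\right)^{N(q;j)},$$ where the infinite products over $i$ converge. The proportion of such elements in the whole group $\mathrm{GL}_n(q)$ converges to the same limit. -/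

import Mathlib

open Filter Topology
open scoped Polynomial Pointwise MatrixGroups

/-- The image of `SL_n(F)` in `GL_n(F)`, as a subgroup. -/
def slSubgroup (n : ℕ) (F : Type*) [Field F] : Subgroup (GL (Fin n) F) :=
  (Matrix.SpecialLinearGroup.toGL (n := Fin n) (R := F)).range

/-- The characteristic polynomial of `A` has no irreducible factor of degree at most `t`. -/
def NoFactorOfDegreeLE {F : Type*} [Field F] {n : ℕ} (t : ℕ) (A : GL (Fin n) F) : Prop :=
  ∀ φ : F[X], Irreducible φ → φ ∣ (A : Matrix (Fin n) (Fin n) F).charpoly → t < φ.natDegree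

/-- The proportion of elements of the finite set `C` whose characteristic polynomial has no
irreducible factor of degree at most `t`. -/
noncomputable def proportion {F : Type*} [Field F] {n : ℕ} (t : ℕ)
    (C : Set (GL (Fin n) F)) : ℝ :=
  ({A ∈ C | NoFactorOfDegreeLE t A}.ncard : ℝ) / (C.ncard : ℝ)

/-- `N(q; j)`: the number of monic irreducible polynomials of degree `j` over `F` (a field with
`q` elements) that have non-zero constant term. -/
noncomputable def numIrred (F : Type*) [Field F] (j : ℕ) : ℕ :=
  {φ : F[X] | φ.Monic ∧ Irreducible φ ∧ φ.natDegree = j ∧ φ.coeff 0 ≠ 0}.ncard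

/-- The factor `(1 - 1 / q ^ (i j)) ^ N(q; j)`, where `q` is the number of elements of `F`. -/
noncomputable def limitFactor (F : Type*) [Field F] (j i : ℕ) : ℝ :=
  (1 - 1 / (Nat.card F : ℝ) ^ (i * j)) ^ numIrred F j

/-- `∏_{j = 1}^t ∏_{i ≥ 1} (1 - 1 / q ^ (i j)) ^ N(q; j)`. -/
noncomputable def limitProduct (F : Type*) [Field F] (t : ℕ) : ℝ :=
  ∏ j ∈ Finset.Icc 1 t, ∏' i : ℕ, limitFactor F j (i + 1)

/-! For a matrix `A`, view `F^n` as an `F[X]`-module with `X` acting by `A`. An irreducible `φ`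
divides the characteristic polynomial iff the `φ`-torsion is nonzero. That torsion has some
dimension `r` over `F[X]/φ`, a field of size `Q = q ^ deg φ`, so `(F[X]/φ)^j` has `∏_{i<j} (Q^r -
Q^i)` embeddings into the module. A finite `q`-binomial identity combines these counts, with weights
`eulerCoeff Q j`, into the indicator of `r = 0`. Multiplying over all small `φ ≠ X` writes the
indicator of `NoFactorOfDegreeLE` as a combination of embedding counts
(`sum_eulerCoeff_mul_numEmbeddings`).

For a fixed source module `U` with `dim U < n`, `SL_n` is transitive on injections `U → F^n`, which
forces the average embedding count over a coset to be exactly 1 (`card_intertwining_pairs_eq`). In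
all cases the average is at most `q - 1`. Dominated convergence then gives the limit `∏_φ ∑_j
eulerCoeff Q j`, and Euler's identity turns each sum into `∏_i (1 - Q^(-i))`. -/

/-! ### Euler's `q`-series -/

/-- The coefficients `∏_{i = 1}^j 1 / (1 - Q ^ i)` of Euler's `q`-exponential. -/
noncomputable def eulerCoeff (Q : ℝ) (j : ℕ) : ℝ :=
  ∏ i ∈ Finset.range j, (1 - Q ^ (i + 1))⁻¹

theorem eulerCoeff_succ (Q : ℝ) (j : ℕ) :
    eulerCoeff Q (j + 1) = eulerCoeff Q j * (1 - Q ^ (j + 1))⁻¹ :=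
  Finset.prod_range_succ _ _

theorem one_sub_pow_succ_ne_zero {Q : ℝ} (hQ : 1 < Q) (i : ℕ) : 1 - Q ^ (i + 1) ≠ 0 :=
  (sub_neg.2 (one_lt_pow₀ hQ i.succ_ne_zero)).ne

/-- The telescoped form of the finite `q`-binomial theorem. -/
theorem sum_eulerCoeff_mul_prod {Q : ℝ} (hQ : 1 < Q) (z : ℝ) (J : ℕ) :
    ∑ j ∈ Finset.range (J + 1), eulerCoeff Q j * ∏ i ∈ Finset.range j, (z - Q ^ i) =
      eulerCoeff Q J * ∏ i ∈ Finset.range J, (z - Q ^ (i + 1)) := by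
  induction J with
  | zero => simp
  | succ J ih =>
    have h := one_sub_pow_succ_ne_zero hQ J
    rw [Finset.sum_range_succ, ih, eulerCoeff_succ, Finset.prod_range_succ' (fun i => z - Q ^ i),
      Finset.prod_range_succ]
    field_simp
    ring

/-- At `z = Q^r` with `1 ≤ r ≤ J` the telescoped product contains the vanishing factor of index `r -
1`. This is the inversion that detects trivial torsion. -/
theorem sum_eulerCoeff_mul_prod_pow {Q : ℝ} (hQ : 1 < Q) {r J : ℕ} (h : r ≤ J) :
    ∑ j ∈ Finset.range (J + 1), eulerCoeff Q j * ∏ i ∈ Finset.range j, (Q ^ r - Q ^ i) =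
      if r = 0 then 1 else 0 := by
  split_ifs with hr
  · subst hr
    rw [Finset.sum_eq_single_of_mem 0 (by simp)]
    · simp [eulerCoeff]
    · intro j _ hj
      rw [Finset.prod_eq_zero (Finset.mem_range.2 (Nat.pos_of_ne_zero hj)) (by simp), mul_zero]
  · rw [sum_eulerCoeff_mul_prod hQ,
      Finset.prod_eq_zero (i := r - 1) (Finset.mem_range.2 (by lia)), mul_zero]
    rw [Nat.sub_add_cancel (Nat.pos_of_ne_zero hr), sub_self]

theorem summable_norm_eulerCoeff {Q : ℝ} (hQ : 1 < Q) : Summable fun j => ‖eulerCoeff Q j‖ := by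
  have hne (j : ℕ) : eulerCoeff Q j ≠ 0 :=
    Finset.prod_ne_zero_iff.2 fun i _ => inv_ne_zero (one_sub_pow_succ_ne_zero hQ i)
  refine summable_of_ratio_test_tendsto_lt_one (l := 0) one_pos
    (Eventually.of_forall fun j => norm_ne_zero_iff.2 (hne j)) ?_
  have h : Tendsto (fun j : ℕ => ‖(1 - Q ^ (j + 1))⁻¹‖) atTop (𝓝 0) := by
    have h1 : Tendsto (fun j : ℕ => Q ^ (j + 1) - 1) atTop atTop :=
      tendsto_atTop_add_const_right _ _
        ((tendsto_add_atTop_iff_nat 1).2 (tendsto_pow_atTop_atTop_of_one_lt hQ))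
    refine (h1.inv_tendsto_atTop.norm.congr fun j => ?_).trans (by simp)
    rw [Pi.inv_apply, norm_inv, norm_inv, norm_sub_rev]
  refine h.congr fun j => ?_
  rw [norm_norm, norm_norm, eulerCoeff_succ, norm_mul, mul_div_cancel_left₀ _
    (norm_ne_zero_iff.2 (hne j))]

theorem multipliable_one_sub_inv_pow {Q : ℝ} (hQ : 1 < Q) :
    Multipliable fun i : ℕ => 1 - 1 / Q ^ (i + 1) := by
  have h : Summable fun i : ℕ => ‖-(1 / Q ^ (i + 1))‖ := by
    have := (summable_nat_add_iff 1).2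
      (summable_geometric_of_lt_one (inv_nonneg.2 (zero_le_one.trans hQ.le))
        (inv_lt_one_of_one_lt₀ hQ))
    refine this.congr fun i => ?_
    rw [norm_neg, one_div, ← inv_pow, Real.norm_of_nonneg (by positivity)]
  simpa [sub_eq_add_neg] using multipliable_one_add_of_summable h

/-- Euler's identity `∑ j, ∏_{i = 1}^j 1 / (1 - Q ^ i) = ∏_{i ≥ 1} (1 - Q ^ (-i))`. -/
theorem tsum_eulerCoeff {Q : ℝ} (hQ : 1 < Q) :
    ∑' j, eulerCoeff Q j = ∏' i : ℕ, (1 - 1 / Q ^ (i + 1)) := by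
  have hQ0 : 0 < Q := zero_lt_one.trans hQ
  have hs := summable_norm_eulerCoeff hQ
  have hle {N : ℕ} : (Q⁻¹) ^ N ≤ 1 := pow_le_one₀ (by positivity) (inv_le_one_of_one_le₀ hQ.le)
  have hsz (N : ℕ) : Summable fun j => eulerCoeff Q j * (Q⁻¹ ^ N) ^ j := by
    refine Summable.of_norm_bounded hs fun j => ?_
    rw [norm_mul, Real.norm_of_nonneg (by positivity : 0 ≤ (Q⁻¹ ^ N) ^ j)]
    exact mul_le_of_le_one_right (norm_nonneg _) (pow_le_one₀ (by positivity) hle)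
  -- With `E(z) = ∑ eulerCoeff Q j * z^j`, this is `E(z) = (1 - z/Q) E(z/Q)` at `z = Q^(-N)`.
  -- Iterating from `z = 1` and using `E(Q^(-N)) → E(0) = 1` gives the product.
  have hstep (N : ℕ) : ∑' j, eulerCoeff Q j * (Q⁻¹ ^ N) ^ j =
      (1 - 1 / Q ^ (N + 1)) * ∑' j, eulerCoeff Q j * (Q⁻¹ ^ (N + 1)) ^ j := by
    rw [sub_mul, one_mul, ← tsum_mul_left, (hsz N).tsum_eq_zero_add,
      (hsz (N + 1)).tsum_eq_zero_add, add_sub_assoc,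
      ← Summable.tsum_sub ((summable_nat_add_iff 1).2 (hsz (N + 1))) ((hsz (N + 1)).mul_left _)]
    congr 1
    refine tsum_congr fun j => ?_
    have h := one_sub_pow_succ_ne_zero hQ j
    rw [eulerCoeff_succ]
    have : 1 / Q ^ (N + 1) = Q⁻¹ ^ (N + 1) := by simp
    rw [this, ← pow_mul, ← pow_mul, ← pow_mul]
    have e : Q ^ (j + 1) * Q⁻¹ ^ ((N + 1) * (j + 1)) = Q⁻¹ ^ (N * (j + 1)) := by
      rw [show (N + 1) * (j + 1) = (j + 1) + N * (j + 1) by ring, pow_add Q⁻¹, ← mul_assoc,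
        ← mul_pow, mul_inv_cancel₀ hQ0.ne', one_pow, one_mul]
    have e' : Q⁻¹ ^ (N + 1) * Q⁻¹ ^ ((N + 1) * j) = Q⁻¹ ^ ((N + 1) * (j + 1)) := by ring
    rw [← e, mul_left_comm (Q⁻¹ ^ (N + 1)), e']
    field_simp
    ring
  have hfin (N : ℕ) : ∑' j, eulerCoeff Q j =
      (∏ i ∈ Finset.range N, (1 - 1 / Q ^ (i + 1))) * ∑' j, eulerCoeff Q j * (Q⁻¹ ^ N) ^ j := by
    induction N with
    | zero => simp
    | succ N ih => rw [ih, hstep, Finset.prod_range_succ, mul_assoc]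
  have h1 : Tendsto (fun N : ℕ => ∑' j, eulerCoeff Q j * (Q⁻¹ ^ N) ^ j) atTop (𝓝 1) := by
    have : ∑' j, (if j = 0 then (1 : ℝ) else 0) = 1 := tsum_ite_eq 0 _
    rw [← this]
    refine tendsto_tsum_of_dominated_convergence hs (fun j => ?_) (Eventually.of_forall
      fun N j => ?_)
    · rcases eq_or_ne j 0 with rfl | hj
      · simp [eulerCoeff]
      · rw [if_neg hj]
        have h0 : Tendsto (fun N : ℕ => Q⁻¹ ^ N) atTop (𝓝 0) :=
          tendsto_pow_atTop_nhds_zero_of_lt_one (by positivity) (inv_lt_one_of_one_lt₀ hQ)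
        simpa [hj] using (h0.pow j).const_mul (eulerCoeff Q j)
    · rw [norm_mul, Real.norm_of_nonneg (by positivity : 0 ≤ (Q⁻¹ ^ N) ^ j)]
      exact mul_le_of_le_one_right (norm_nonneg _) (pow_le_one₀ (by positivity) hle)
  have h2 := (multipliable_one_sub_inv_pow hQ).tendsto_prod_tprod_nat.mul h1
  rw [mul_one] at h2
  exact tendsto_nhds_unique (tendsto_const_nhds.congr hfin) h2

/-! ### Products of absolutely convergent series -/

section PiSeries

variable {ι : Type*} [Fintype ι] [DecidableEq ι]

theorem sum_piFinset_range_prod (c : ι → ℕ → ℝ) (N : ℕ) :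
    ∑ j ∈ Fintype.piFinset fun _ : ι => Finset.range N, ∏ a, c a (j a) =
      ∏ a, ∑ k ∈ Finset.range N, c a k :=
  (Finset.prod_univ_sum _ _).symm

theorem tendsto_piFinset_range :
    Tendsto (fun N : ℕ => Fintype.piFinset fun _ : ι => Finset.range N) atTop atTop := by
  refine tendsto_atTop_finset_of_monotone
    (fun a b h => Fintype.piFinset_subset _ _ fun _ => Finset.range_mono h) fun j => ?_
  refine ⟨∑ a, j a + 1, Fintype.mem_piFinset.2 fun a => Finset.mem_range.2 ?_⟩
  exact Nat.lt_succ_of_le (Finset.single_le_sum (fun _ _ => Nat.zero_le _) (Finset.mem_univ a))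

/-- Every finite index set lies in a box, and over a box the sum factors. -/
theorem summable_norm_prod_pi {c : ι → ℕ → ℝ} (hc : ∀ a, Summable fun k => ‖c a k‖) :
    Summable fun j : ι → ℕ => ‖∏ a, c a (j a)‖ := by
  refine summable_of_sum_le (c := ∏ a, ∑' k, ‖c a k‖) (fun _ => norm_nonneg _) fun u => ?_
  obtain ⟨N, hN⟩ := (tendsto_piFinset_range.eventually_ge_atTop u).exists
  calc ∑ j ∈ u, ‖∏ a, c a (j a)‖
      ≤ ∑ j ∈ Fintype.piFinset fun _ : ι => Finset.range N, ‖∏ a, c a (j a)‖ :=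
        Finset.sum_le_sum_of_subset_of_nonneg hN fun _ _ _ => norm_nonneg _
    _ = ∏ a, ∑ k ∈ Finset.range N, ‖c a k‖ := by
        simp_rw [norm_prod, ← sum_piFinset_range_prod fun a k => ‖c a k‖]
    _ ≤ _ := Finset.prod_le_prod (fun _ _ => Finset.sum_nonneg fun _ _ => norm_nonneg _)
        fun a _ => (hc a).sum_le_tsum _ fun _ _ => norm_nonneg _

theorem tsum_prod_pi {c : ι → ℕ → ℝ} (hc : ∀ a, Summable fun k => ‖c a k‖) :
    ∑' j : ι → ℕ, ∏ a, c a (j a) = ∏ a, ∑' k, c a k := by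
  have h1 := (summable_norm_prod_pi hc).of_norm.hasSum.comp tendsto_piFinset_range
  have h2 : Tendsto (fun N => ∏ a, ∑ k ∈ Finset.range N, c a k) atTop (𝓝 (∏ a, ∑' k, c a k)) :=
    tendsto_finsetProd _ fun a _ => (hc a).of_norm.hasSum.tendsto_sum_nat
  exact tendsto_nhds_unique h1 (h2.congr fun N => (sum_piFinset_range_prod c N).symm)

/-- Tannery's theorem for sums over growing boxes with bounded weights tending to `1`. -/
theorem tendsto_sum_piFinset_mul {c : ι → ℕ → ℝ} (hc : ∀ a, Summable fun k => ‖c a k‖)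
    {w : ℕ → (ι → ℕ) → ℝ} {B : ℝ} (hB : ∀ n j, ‖w n j‖ ≤ B)
    (hw : ∀ j, ∀ᶠ n in atTop, w n j = 1) :
    Tendsto (fun n => ∑ j ∈ Fintype.piFinset fun _ : ι => Finset.range (n + 1),
      (∏ a, c a (j a)) * w n j) atTop (𝓝 (∏ a, ∑' k, c a k)) := by
  rw [← tsum_prod_pi hc]
  have key : Tendsto (fun n => ∑' j : ι → ℕ,
      if j ∈ Fintype.piFinset fun _ : ι => Finset.range (n + 1) then (∏ a, c a (j a)) * w n j
        else 0) atTop (𝓝 (∑' j : ι → ℕ, ∏ a, c a (j a))) := by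
    refine tendsto_tsum_of_dominated_convergence ((summable_norm_prod_pi hc).mul_right B)
      (fun j => ?_) (Eventually.of_forall fun n j => ?_)
    · refine tendsto_const_nhds.congr' ?_
      have hmem := ((tendsto_add_atTop_nat 1).eventually
        (tendsto_piFinset_range (ι := ι).eventually_ge_atTop {j}))
      filter_upwards [hw j, hmem] with n h1 h2
      rw [if_pos (h2 (Finset.mem_singleton_self j)), h1, mul_one]
    · split_ifs
      · rw [norm_mul]
        exact mul_le_mul_of_nonneg_left (hB n j) (norm_nonneg _)
      · rw [norm_zero]
        exact mul_nonneg (norm_nonneg _) ((norm_nonneg _).trans (hB n j))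
  refine key.congr fun n => ?_
  rw [tsum_eq_sum (s := Fintype.piFinset fun _ : ι => Finset.range (n + 1))
    fun j hj => if_neg hj]
  exact Finset.sum_congr rfl fun j hj => if_pos hj

end PiSeries

/-! ### Counting embeddings through torsion -/

section Torsion

open Submodule

variable {R M : Type*} [CommRing R] [AddCommGroup M] [Module R M]

theorem smul_quotient_span_singleton_pi {κ : Type*} (a : R) (x : κ → R ⧸ Ideal.span {a}) :
    a • x = 0 := by
  funext i
  obtain ⟨y, hy⟩ := Ideal.Quotient.mk_surjective (x i)
  rw [Pi.smul_apply, ← hy, Pi.zero_apply]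
  exact (Ideal.Quotient.eq_zero_iff_mem (a := a * y)).2
    (Ideal.mul_mem_right _ _ (Ideal.mem_span_singleton_self a))

/-- Injective `R`-linear maps from a power of `R ⧸ (a)` correspond to tuples of `a`-torsion
elements that are linearly independent over `R ⧸ (a)`. -/
theorem card_injective_pi_quotient_eq_card_linearIndependent (a : R) (j : ℕ) :
    Nat.card {f : (Fin j → R ⧸ Ideal.span {a}) →ₗ[R] M // Function.Injective f} =
      Nat.card {v : Fin j → torsionBy R M a // LinearIndependent (R ⧸ Ideal.span {a}) v} := by
  symm
  refine Nat.card_eq_of_bijective (fun v => ⟨(torsionBy R M a).subtype ∘ₗ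
    (Fintype.linearCombination (R ⧸ Ideal.span {a}) v.1).restrictScalars R, ?_⟩) ⟨?_, ?_⟩
  · exact Subtype.val_injective.comp (linearIndependent_iff_injective_fintypeLinearCombination.1 v.2)
  · intro v w h
    ext i
    have := LinearMap.congr_fun (congrArg Subtype.val h) (Pi.single i 1)
    simpa [Fintype.linearCombination_apply_single] using this
  · rintro ⟨f, hf⟩
    have hmem (x) : f x ∈ torsionBy R M a := by
      rw [mem_torsionBy_iff, ← map_smul, smul_quotient_span_singleton_pi, map_zero]
    have hsurj : Function.Surjective (algebraMap R (R ⧸ Ideal.span {a})) :=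
      Ideal.Quotient.mk_surjective
    let g : (Fin j → R ⧸ Ideal.span {a}) →ₗ[R ⧸ Ideal.span {a}] torsionBy R M a :=
      (f.codRestrict (torsionBy R M a) hmem).extendScalarsOfSurjective hsurj
    have hg : Fintype.linearCombination (R ⧸ Ideal.span {a}) (fun i => g (Pi.single i 1)) = g := by
      refine LinearMap.pi_ext' fun i => LinearMap.ext_ring ?_
      simp [Fintype.linearCombination_apply_single]
    refine ⟨⟨fun i => g (Pi.single i 1), ?_⟩, ?_⟩
    · rw [linearIndependent_iff_injective_fintypeLinearCombination, hg]
      exact fun x y h => hf (congrArg Subtype.val h)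
    · refine Subtype.ext (LinearMap.ext fun x => ?_)
      simp only [LinearMap.comp_apply, LinearMap.restrictScalars_apply, hg]
      rfl

/-- Here `r` is the dimension of the torsion over the residue field, and the product counts linearly
independent `j`-tuples. For `j > r` it vanishes through the factor `i = r`, so one formula serves
every `j`. -/
theorem exists_card_torsionBy_eq_pow [Finite M] (a : R) [(Ideal.span {a}).IsMaximal]
    [Finite (R ⧸ Ideal.span {a})] :
    ∃ r : ℕ, Nat.card (torsionBy R M a) = Nat.card (R ⧸ Ideal.span {a}) ^ r ∧
      ∀ j : ℕ, (Nat.card {f : (Fin j → R ⧸ Ideal.span {a}) →ₗ[R] M // Function.Injective f} : ℝ) =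
        ∏ i ∈ Finset.range j, ((Nat.card (R ⧸ Ideal.span {a}) : ℝ) ^ r -
          (Nat.card (R ⧸ Ideal.span {a}) : ℝ) ^ i) := by
  let : Field (R ⧸ Ideal.span {a}) := Ideal.Quotient.field _
  have := Fintype.ofFinite (R ⧸ Ideal.span {a})
  refine ⟨Module.finrank (R ⧸ Ideal.span {a}) (torsionBy R M a),
    Module.natCard_eq_pow_finrank, fun j => ?_⟩
  rw [card_injective_pi_quotient_eq_card_linearIndependent]
  have hq : 1 ≤ Nat.card (R ⧸ Ideal.span {a}) := Nat.card_pos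
  rcases le_or_gt j (Module.finrank (R ⧸ Ideal.span {a}) (torsionBy R M a)) with h | h
  · rw [card_linearIndependent h, Finset.prod_range, Nat.cast_prod]
    refine Finset.prod_congr rfl fun i _ => ?_
    rw [← Nat.card_eq_fintype_card, Nat.cast_sub (Nat.pow_le_pow_right hq (i.2.le.trans h))]
    push_cast
    rfl
  · rw [Finset.prod_eq_zero (Finset.mem_range.2 h) (sub_self _), Nat.cast_eq_zero]
    refine @Nat.card_of_isEmpty _ ⟨fun v => ?_⟩
    have := v.2.fintype_card_le_finrank
    rw [Fintype.card_fin] at this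
    exact this.not_gt h

variable {ι : Type*} [Fintype ι] [DecidableEq ι] {a : ι → R}

/-- Each `x i` is killed by `a i` and, being minus the sum of the others, by the product of the
other `a k`; these two annihilators are coprime. -/
theorem eq_zero_of_sum_eq_zero_of_torsion (ha : Pairwise fun i k => IsCoprime (a i) (a k))
    {x : ι → M} (hx : ∀ i, a i • x i = 0) (h : ∑ i, x i = 0) (i : ι) : x i = 0 := by
  obtain ⟨u, v, huv⟩ : IsCoprime (a i) (∏ k ∈ Finset.univ.erase i, a k) :=
    IsCoprime.prod_right fun k hk => ha (Finset.ne_of_mem_erase hk).symm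
  have h1 : (∏ k ∈ Finset.univ.erase i, a k) • x i = 0 := by
    rw [← Finset.add_sum_erase _ _ (Finset.mem_univ i)] at h
    rw [eq_neg_of_add_eq_zero_left h, smul_neg, Finset.smul_sum, neg_eq_zero]
    refine Finset.sum_eq_zero fun k hk => ?_
    rw [← Finset.mul_prod_erase _ _ hk, mul_comm, mul_smul, hx, smul_zero]
  rw [← one_smul R (x i), ← huv, add_smul, mul_smul, mul_smul, hx, h1, smul_zero, smul_zero,
    add_zero]

/-- Injective maps out of a product of modules killed by pairwise coprime elements correspond
to families of injective maps. -/
theorem card_injective_pi_eq_prod (ha : Pairwise fun i k => IsCoprime (a i) (a k))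
    {N : ι → Type*} [∀ i, AddCommGroup (N i)] [∀ i, Module R (N i)]
    (hN : ∀ i (x : N i), a i • x = 0) :
    Nat.card {f : (∀ i, N i) →ₗ[R] M // Function.Injective f} =
      ∏ i, Nat.card {f : N i →ₗ[R] M // Function.Injective f} := by
  rw [← Nat.card_pi]
  refine Nat.card_eq_of_bijective
    (fun f i => ⟨f.1 ∘ₗ LinearMap.single R N i, f.2.comp (Pi.single_injective i)⟩) ⟨?_, ?_⟩
  · intro f g h
    refine Subtype.ext (LinearMap.pi_ext' fun i => ?_)
    exact congrArg Subtype.val (congrFun h i)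
  · intro g
    refine ⟨⟨LinearMap.lsum R N R fun i => (g i).1, ?_⟩, ?_⟩
    · rw [injective_iff_map_eq_zero]
      intro x hx
      rw [LinearMap.lsum_apply, LinearMap.sum_apply] at hx
      funext i
      refine (injective_iff_map_eq_zero (g i).1).1 (g i).2 _ ?_
      refine eq_zero_of_sum_eq_zero_of_torsion ha (x := fun i => (g i).1 (x i)) (fun i => ?_) hx i
      rw [← map_smul, hN, map_zero]
    · funext i
      refine Subtype.ext (LinearMap.ext fun x => ?_)
      simp only [LinearMap.lsum_apply, LinearMap.comp_apply, LinearMap.sum_apply,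
        LinearMap.proj_apply, LinearMap.single_apply]
      rw [Finset.sum_eq_single i, Pi.single_eq_same]
      · intro k _ hk
        rw [Pi.single_eq_of_ne hk, map_zero]
      · exact fun h => absurd (Finset.mem_univ i) h

end Torsion

/-! ### Irreducible factors of the characteristic polynomial -/

section Charpoly

open Module Polynomial

variable {F : Type*} [Field F] {n : ℕ}

/-- A root of `φ` in the algebraic closure is an eigenvalue of `A`, so `φ(A)` is singular there. Its
determinant already lies in `F`, so it is singular over `F`. -/
theorem exists_aeval_mulVec_eq_zero_of_dvd_charpoly {A : Matrix (Fin n) (Fin n) F} {φ : F[X]}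
    (hφ : Irreducible φ) (h : φ ∣ A.charpoly) :
    ∃ v, v ≠ 0 ∧ (aeval A φ).mulVec v = 0 := by
  obtain ⟨α, hα⟩ := IsAlgClosed.exists_aeval_eq_zero (AlgebraicClosure F) φ
    (Polynomial.degree_pos_of_irreducible hφ).ne'
  set m : Matrix (Fin n) (Fin n) F →ₐ[F] Matrix (Fin n) (Fin n) (AlgebraicClosure F) :=
    (Algebra.ofId F (AlgebraicClosure F)).mapMatrix
  have hroot : (m A).charpoly.IsRoot α := by
    have : (m A).charpoly = A.charpoly.map (algebraMap F (AlgebraicClosure F)) :=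
      Matrix.charpoly_map A (algebraMap F (AlgebraicClosure F))
    rw [this, IsRoot.def, eval_map_algebraMap]
    obtain ⟨ψ, hψ⟩ := h
    rw [hψ, map_mul, hα, zero_mul]
  have hev : Module.End.HasEigenvalue (Matrix.toLin' (m A)) α := by
    rw [Module.End.hasEigenvalue_iff_isRoot_charpoly, Matrix.charpoly_toLin']
    exact hroot
  obtain ⟨w, hw⟩ := hev.exists_hasEigenvector
  have hzero : (m (aeval A φ)).mulVec w = 0 := by
    have h1 := Module.End.aeval_apply_of_hasEigenvector
      (p := φ.map (algebraMap F (AlgebraicClosure F))) hw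
    rw [eval_map_algebraMap, hα, zero_smul] at h1
    have h2 : aeval (Matrix.toLin' (m A)) (φ.map (algebraMap F (AlgebraicClosure F))) =
        Matrix.toLin' (m (aeval A φ)) := by
      rw [aeval_map_algebraMap, ← aeval_algHom_apply]
      exact (aeval_algHom_apply
        ((Matrix.toLinAlgEquiv' (R := AlgebraicClosure F) (n := Fin n)).toAlgHom.restrictScalars F)
        (m A) φ)
    rwa [h2, Matrix.toLin'_apply] at h1
  have hdet : (m (aeval A φ)).det = 0 := Matrix.exists_mulVec_eq_zero_iff.1 ⟨w, hw.2, hzero⟩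
  have hmap : (m (aeval A φ)).det = algebraMap F (AlgebraicClosure F) (aeval A φ).det :=
    ((algebraMap F (AlgebraicClosure F)).map_det _).symm
  rw [hmap, map_eq_zero] at hdet
  exact Matrix.exists_mulVec_eq_zero_iff.2 hdet

theorem aeval_toLin'_eq (A : Matrix (Fin n) (Fin n) F) (φ : F[X]) :
    aeval (Matrix.toLin' A) φ = Matrix.toLin' (aeval A φ) :=
  aeval_algHom_apply (Matrix.toLinAlgEquiv' (R := F) (n := Fin n)).toAlgHom A φ

theorem mem_torsionBy_aeval'_iff (A : Matrix (Fin n) (Fin n) F) (φ : F[X]) (v : Fin n → F) :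
    AEval'.of (Matrix.toLin' A) v ∈ Submodule.torsionBy F[X] (AEval' (Matrix.toLin' A)) φ ↔
      (aeval A φ).mulVec v = 0 := by
  rw [Submodule.mem_torsionBy_iff, ← Matrix.toLin'_apply, ← aeval_toLin'_eq]
  change φ • AEval.of F (Fin n → F) _ v = 0 ↔ _
  rw [← AEval.of_aeval_smul, LinearEquiv.map_eq_zero_iff]
  rfl

theorem dvd_charpoly_iff_torsionBy_ne_bot {A : Matrix (Fin n) (Fin n) F} {φ : F[X]}
    (hφ : Irreducible φ) :
    φ ∣ A.charpoly ↔ Submodule.torsionBy F[X] (AEval' (Matrix.toLin' A)) φ ≠ ⊥ := by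
  rw [Submodule.ne_bot_iff]
  constructor
  · intro h
    obtain ⟨v, hv, h0⟩ := exists_aeval_mulVec_eq_zero_of_dvd_charpoly hφ h
    exact ⟨AEval'.of _ v, (mem_torsionBy_aeval'_iff A φ v).2 h0,
      (LinearEquiv.map_ne_zero_iff _).2 hv⟩
  · rintro ⟨x, hx, hx0⟩
    by_contra hdvd
    -- By Cayley–Hamilton, `u * φ + w * A.charpoly = 1` would kill the torsion vector.
    obtain ⟨u, w, huw⟩ := (hφ.coprime_iff_not_dvd.2 hdvd)
    obtain ⟨v, rfl⟩ := (AEval'.of (Matrix.toLin' A)).surjective x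
    rw [mem_torsionBy_aeval'_iff] at hx
    have h1 : (aeval A (u * φ + w * A.charpoly)).mulVec v = 0 := by
      rw [map_add, map_mul, map_mul, Matrix.aeval_self_charpoly, mul_zero, add_zero,
        ← Matrix.mulVec_mulVec, hx, Matrix.mulVec_zero]
    rw [huw, map_one, Matrix.one_mulVec] at h1
    exact hx0 (by rw [h1, map_zero])

end Charpoly

/-! ### Transitivity on injections and the averaging argument -/

section Action

open Module

variable {F : Type*} [Field F] {n : ℕ} {U : Type*} [AddCommGroup U] [Module F U]

/-- Composition of a linear map into `Fⁿ` with an invertible matrix. -/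
def glComp (A : GL (Fin n) F) (f : U →ₗ[F] (Fin n → F)) : U →ₗ[F] (Fin n → F) :=
  Matrix.toLin' (A : Matrix (Fin n) (Fin n) F) ∘ₗ f

theorem glComp_mul (A B : GL (Fin n) F) (f : U →ₗ[F] (Fin n → F)) :
    glComp (A * B) f = glComp A (glComp B f) := by
  simp [glComp, Matrix.toLin'_mul, LinearMap.comp_assoc]

theorem glComp_one (f : U →ₗ[F] (Fin n → F)) : glComp 1 f = f := by
  simp [glComp]

theorem glComp_inv_eq_iff {A : GL (Fin n) F} {f g : U →ₗ[F] (Fin n → F)} :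
    glComp A⁻¹ f = g ↔ f = glComp A g := by
  constructor
  · rintro rfl
    rw [← glComp_mul, mul_inv_cancel, glComp_one]
  · rintro rfl
    rw [← glComp_mul, inv_mul_cancel, glComp_one]

theorem glComp_injective (A : GL (Fin n) F) {f : U →ₗ[F] (Fin n → F)}
    (hf : Function.Injective f) : Function.Injective (glComp A f) := by
  intro x y h
  have h2 : glComp A⁻¹ (glComp A f) = f := glComp_inv_eq_iff.2 rfl
  rw [← h2] at hf
  exact hf (congrArg (Matrix.toLin' ((A⁻¹ : GL (Fin n) F) : Matrix (Fin n) (Fin n) F)) h)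

theorem exists_gl_coe_eq {g : (Fin n → F) →ₗ[F] (Fin n → F)} (hg : IsUnit (LinearMap.det g)) :
    ∃ A : GL (Fin n) F, Matrix.toLin' (A : Matrix (Fin n) (Fin n) F) = g := by
  rw [← LinearMap.det_toMatrix'] at hg
  exact ⟨Matrix.nonsingInvUnit _ hg, Matrix.toLin'_toMatrix' g⟩

theorem exists_glComp_eq [FiniteDimensional F U] {f g : U →ₗ[F] (Fin n → F)}
    (hf : Function.Injective f) (hg : Function.Injective g) :
    ∃ A : GL (Fin n) F, glComp A f = g := by
  obtain ⟨e, he⟩ := Submodule.exists_linearEquiv_restrict_eq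
    ((LinearEquiv.ofInjective f hf).symm.trans (LinearEquiv.ofInjective g hg))
  obtain ⟨A, hA⟩ := exists_gl_coe_eq (LinearEquiv.isUnit_det' e)
  refine ⟨A, LinearMap.ext fun x => ?_⟩
  have := he (LinearEquiv.ofInjective f hf x)
  rw [LinearEquiv.trans_apply, LinearEquiv.symm_apply_apply] at this
  rw [glComp, hA]
  exact this.symm

theorem slSubgroup_eq_ker_det : slSubgroup n F = (Matrix.GeneralLinearGroup.det).ker := by
  refine SetLike.coe_injective ?_
  exact Matrix.SpecialLinearGroup.range_toGL

/-- An element of `GL_n` carries `f` to `g`. Since the image of `g` is proper, some map fixing that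
image pointwise corrects the determinant to 1. -/
theorem exists_mem_slSubgroup_glComp_eq [FiniteDimensional F U] (hU : finrank F U < n)
    {f g : U →ₗ[F] (Fin n → F)} (hf : Function.Injective f) (hg : Function.Injective g) :
    ∃ A ∈ slSubgroup n F, glComp A f = g := by
  obtain ⟨A, hA⟩ := exists_glComp_eq hf hg
  have hlt : LinearMap.range g < ⊤ := by
    refine lt_top_iff_ne_top.2 fun h => ?_
    have h1 := LinearMap.finrank_range_of_inj hg
    rw [h, finrank_top, finrank_fin_fun] at h1
    exact hU.ne h1.symm
  obtain ⟨ℓ, hℓ0, hℓ⟩ := Submodule.exists_le_ker_of_lt_top _ hlt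
  obtain ⟨v, hv⟩ : ∃ v, ℓ v ≠ 0 := by
    by_contra! h
    exact hℓ0 (LinearMap.ext h)
  let d : F := ((Matrix.GeneralLinearGroup.det A)⁻¹ : Fˣ)
  -- The vector is scaled so that `1 + ℓ(...) = d`.
  have hdet : LinearMap.det (LinearMap.transvection ℓ (((d - 1) / ℓ v) • v)) = d := by
    rw [LinearMap.transvection.det, map_smul, smul_eq_mul, div_mul_cancel₀ _ hv]
    ring
  obtain ⟨B, hB⟩ := exists_gl_coe_eq (n := n) (by rw [hdet]; exact Units.isUnit _)
  refine ⟨B * A, ?_, ?_⟩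
  · rw [slSubgroup_eq_ker_det, MonoidHom.mem_ker, map_mul]
    have : Matrix.GeneralLinearGroup.det B = (Matrix.GeneralLinearGroup.det A)⁻¹ := by
      refine Units.ext ?_
      rw [Matrix.GeneralLinearGroup.val_det_apply, ← LinearMap.det_toLin', hB, hdet]
    rw [this, inv_mul_cancel]
  · rw [glComp_mul, hA, glComp, hB]
    refine LinearMap.ext fun x => ?_
    have : ℓ (g x) = 0 := hℓ (LinearMap.mem_range_self g x)
    simp [LinearMap.transvection.apply, this]

/-- If `H` acts transitively on injections `U → Fⁿ`, then in a left `H`-invariant set of matrices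
there are on average exactly one injection intertwining `τ` with the matrix. -/
theorem card_intertwining_pairs_eq {H : Subgroup (GL (Fin n) F)} {C : Set (GL (Fin n) F)}
    (hC : ∀ B ∈ H, ∀ A ∈ C, B * A ∈ C)
    (hH : ∀ f g : U →ₗ[F] (Fin n → F), Function.Injective f → Function.Injective g →
      ∃ A ∈ H, glComp A f = g)
    {τ : U →ₗ[F] U} (hτ : Function.Injective τ) {f₀ : U →ₗ[F] (Fin n → F)}
    (hf₀ : Function.Injective f₀) :
    Nat.card {p : (U →ₗ[F] (Fin n → F)) × GL (Fin n) F //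
      p.2 ∈ C ∧ Function.Injective p.1 ∧ glComp p.2 p.1 = p.1 ∘ₗ τ} = C.ncard := by
  -- `D f` carries `f ∘ τ` to `f₀`, so `E = D f * A` carries `f` to `f₀`. Thus `E` determines `f =
  -- E⁻¹ f₀` and then `A`, making `(f, A) ↦ E` a bijection onto `C`.
  choose! D hDH hD using fun (f : U →ₗ[F] (Fin n → F)) (hf : Function.Injective f) =>
    hH (f ∘ₗ τ) f₀ (by rw [LinearMap.coe_comp]; exact hf.comp hτ) hf₀
  rw [← Nat.card_coe_set_eq]
  refine Nat.card_eq_of_bijective (fun p => ⟨D p.1.1 * p.1.2, hC _ (hDH _ p.2.2.1) _ p.2.1⟩)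
    ⟨?_, ?_⟩
  · rintro ⟨⟨f, A⟩, hA, hf, hAf⟩ ⟨⟨g, B⟩, hB, hg, hBg⟩ h
    have h : D f * A = D g * B := congrArg Subtype.val h
    have hf1 : glComp (D f * A) f = f₀ := by rw [glComp_mul, hAf, hD f hf]
    have hg1 : glComp (D g * B) g = f₀ := by rw [glComp_mul, hBg, hD g hg]
    have hfg : f = g := by
      rw [← glComp_inv_eq_iff.2 hf1.symm, ← glComp_inv_eq_iff.2 hg1.symm, h]
    subst hfg
    have hAB : A = B := mul_left_cancel h
    subst hAB
    rfl
  · rintro ⟨E, hE⟩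
    have hf := glComp_injective E⁻¹ hf₀
    refine ⟨⟨(glComp E⁻¹ f₀, (D (glComp E⁻¹ f₀))⁻¹ * E),
      hC _ (H.inv_mem (hDH _ hf)) _ hE, hf, ?_⟩, Subtype.ext (mul_inv_cancel_left _ _)⟩
    rw [glComp_mul, glComp_inv_eq_iff, hD _ hf]
    exact (glComp_inv_eq_iff.1 rfl).symm

/-- The `F[X]`-linear maps from `U` to `Fⁿ`, with `X` acting by `A`, are the linear maps that
intertwine multiplication by `X` with `A`. -/
theorem card_injective_aeval' {U : Type*} [AddCommGroup U] [Module F U] [Module F[X] U]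
    [IsScalarTower F F[X] U] (A : GL (Fin n) F) :
    Nat.card {f : U →ₗ[F[X]] AEval' (Matrix.toLin' (A : Matrix (Fin n) (Fin n) F)) //
      Function.Injective f} =
    Nat.card {f : U →ₗ[F] (Fin n → F) // Function.Injective f ∧
      glComp A f = f ∘ₗ (LinearMap.lsmul F[X] U Polynomial.X).restrictScalars F} := by
  let e := AEval'.of (Matrix.toLin' (A : Matrix (Fin n) (Fin n) F))
  refine Nat.card_eq_of_bijective (fun f => ⟨e.symm.toLinearMap ∘ₗ f.1.restrictScalars F,
    e.symm.injective.comp f.2, ?_⟩) ⟨?_, ?_⟩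
  · refine LinearMap.ext fun x => e.injective ?_
    have : e (Matrix.toLin' (A : Matrix (Fin n) (Fin n) F) (e.symm (f.1 x))) =
        (Polynomial.X : F[X]) • f.1 x := by
      rw [← AEval'.X_smul_of]
      exact congrArg _ (e.apply_symm_apply _)
    refine this.trans ?_
    rw [← map_smul]
    exact (e.apply_symm_apply _).symm
  · intro f g h
    refine Subtype.ext (LinearMap.ext fun x => e.symm.injective ?_)
    exact LinearMap.congr_fun (congrArg Subtype.val h) x
  · rintro ⟨f, hf, hAf⟩
    have hX (x : U) : e (f ((Polynomial.X : F[X]) • x)) = (Polynomial.X : F[X]) • e (f x) := by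
      rw [AEval'.X_smul_of]
      exact congrArg e (LinearMap.congr_fun hAf x).symm
    have hsmul (p : F[X]) (x : U) : e (f (p • x)) = p • e (f x) := by
      induction p using Polynomial.induction_on generalizing x with
      | C a =>
        rw [← Polynomial.algebraMap_eq, algebraMap_smul, algebraMap_smul, map_smul, map_smul]
      | add p q hp hq => rw [add_smul, map_add, map_add, hp, hq, add_smul]
      | monomial k a h =>
        rw [pow_succ, ← mul_assoc, mul_smul, h, hX, ← mul_smul]
    refine ⟨⟨{ toFun := fun x => e (f x)
               map_add' := fun x y => by rw [map_add, map_add]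
               map_smul' := hsmul }, e.injective.comp hf⟩, ?_⟩
    exact Subtype.ext (LinearMap.ext fun x => e.symm_apply_apply _)

/-- `C` contains a full right coset of `SL_n`, whose index is at most the number of possible
determinants. -/
theorem ncard_gl_le [Finite F] {C : Set (GL (Fin n) F)} (hne : C.Nonempty)
    (hC : ∀ B ∈ slSubgroup n F, ∀ A ∈ C, B * A ∈ C) :
    Nat.card (GL (Fin n) F) ≤ Nat.card Fˣ * C.ncard := by
  obtain ⟨A, hA⟩ := hne
  rw [(slSubgroup n F).card_eq_card_quotient_mul_card_subgroup]
  refine Nat.mul_le_mul ?_ ?_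
  · rw [slSubgroup_eq_ker_det]
    exact Nat.card_le_card_of_injective _ (QuotientGroup.kerLift_injective _)
  · rw [← Nat.card_coe_set_eq]
    exact Nat.card_le_card_of_injective (fun B => (⟨B.1 * A, hC _ B.2 _ hA⟩ : C))
      fun B B' h => Subtype.ext (mul_right_cancel (congrArg Subtype.val h))

end Action

/-! ### Small irreducible polynomials and the inversion formula -/

section Factors

open Module Polynomial

variable (F : Type*) [Field F] (t : ℕ)

/-- The monic irreducible polynomials of degree at most `t` with non-zero constant term. -/
def smallIrred : Set F[X] :=
  {φ | φ.Monic ∧ Irreducible φ ∧ φ.natDegree ≤ t ∧ φ.coeff 0 ≠ 0}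

theorem finite_smallIrred [Finite F] : (smallIrred F t).Finite := by
  have : Finite (degreeLT F (t + 1)) := Finite.of_equiv _ (degreeLTEquiv F (t + 1)).toEquiv.symm
  refine Set.Finite.subset (Set.toFinite (degreeLT F (t + 1) : Set F[X])) fun φ hφ => ?_
  refine mem_degreeLT.2 (lt_of_le_of_lt degree_le_natDegree ?_)
  exact_mod_cast Nat.lt_succ_of_le hφ.2.2.1

noncomputable instance [Finite F] : Fintype (smallIrred F t) := (finite_smallIrred F t).fintype

variable {F t}

theorem pairwise_isCoprime_smallIrred :
    Pairwise fun φ ψ : smallIrred F t => IsCoprime φ.1 ψ.1 := by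
  intro φ ψ h
  refine φ.2.2.1.coprime_iff_not_dvd.2 fun hdvd => h (Subtype.ext ?_)
  exact eq_of_monic_of_associated φ.2.1 ψ.2.1 (φ.2.2.1.associated_of_dvd ψ.2.2.1 hdvd)

theorem one_lt_card_pow [Finite F] (φ : smallIrred F t) :
    1 < Nat.card F ^ φ.1.natDegree :=
  Nat.one_lt_pow φ.2.2.1.natDegree_pos.ne' Finite.one_lt_card

theorem finite_polynomial_quotient (φ : smallIrred F t) :
    Module.Finite F (F[X] ⧸ Ideal.span {φ.1}) :=
  φ.2.1.finite_quotient

theorem natCard_polynomial_quotient [Finite F] (φ : smallIrred F t) :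
    Nat.card (F[X] ⧸ Ideal.span {φ.1}) = Nat.card F ^ φ.1.natDegree := by
  have := finite_polynomial_quotient φ
  rw [Module.natCard_eq_pow_finrank (K := F), finrank_quotient_span_eq_natDegree]

theorem noFactorOfDegreeLE_iff {n : ℕ} (A : GL (Fin n) F) :
    NoFactorOfDegreeLE t A ↔ ∀ φ ∈ smallIrred F t, Submodule.torsionBy F[X]
      (AEval' (Matrix.toLin' (A : Matrix (Fin n) (Fin n) F))) φ = ⊥ := by
  constructor
  · intro h φ hφ
    by_contra hne
    exact (h φ hφ.2.1 ((dvd_charpoly_iff_torsionBy_ne_bot hφ.2.1).2 hne)).not_ge hφ.2.2.1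
  · classical
    intro h φ hφ hdvd
    by_contra! hle
    have hass : Associated (normalize φ) φ := normalize_associated φ
    have hirr : Irreducible (normalize φ) := hass.symm.irreducible hφ
    have hdvd' : normalize φ ∣ (A : Matrix (Fin n) (Fin n) F).charpoly := hass.dvd.trans hdvd
    refine (dvd_charpoly_iff_torsionBy_ne_bot hirr).1 hdvd'
      (h _ ⟨monic_normalize hφ.ne_zero, hirr, ?_, fun h0 => ?_⟩)
    · rwa [natDegree_eq_of_degree_eq degree_normalize]
    -- A zero constant term would make `X` divide the characteristic polynomial, contradicting
    -- invertibility; so omitting `X` loses nothing.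
    · have hX : (X : F[X]) ∣ (A : Matrix (Fin n) (Fin n) F).charpoly :=
        (X_dvd_iff.2 h0).trans hdvd'
      have hdet : IsUnit (A : Matrix (Fin n) (Fin n) F).det :=
        (Matrix.isUnit_iff_isUnit_det _).1 A.isUnit
      rw [X_dvd_iff] at hX
      rw [Matrix.det_eq_sign_charpoly_coeff, hX, mul_zero] at hdet
      exact not_isUnit_zero hdet

/-- The `F[X]`-module `∏_φ (F[X] / φ) ^ (j φ)`. -/
abbrev PiQuotient (j : smallIrred F t → ℕ) : Type _ :=
  ∀ φ : smallIrred F t, Fin (j φ) → F[X] ⧸ Ideal.span {φ.1}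

/-- Number of occurrences of `∏_φ (F[X] / φ) ^ (j φ)` inside `Fⁿ` with `X` acting by `A`. -/
noncomputable def numEmbeddings {n : ℕ} (A : GL (Fin n) F) (j : smallIrred F t → ℕ) : ℕ :=
  Nat.card {f : PiQuotient j →ₗ[F[X]] AEval' (Matrix.toLin' (A : Matrix (Fin n) (Fin n) F)) //
    Function.Injective f}

open Classical in
/-- Möbius-type inversion: the indicator of `NoFactorOfDegreeLE` in terms of embeddings. -/
theorem sum_eulerCoeff_mul_numEmbeddings [Finite F] {n : ℕ} (A : GL (Fin n) F) :
    ∑ j ∈ Fintype.piFinset fun _ : smallIrred F t => Finset.range (n + 1),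
      (∏ φ, eulerCoeff ((Nat.card F : ℝ) ^ φ.1.natDegree) (j φ)) * (numEmbeddings A j : ℝ) =
      if NoFactorOfDegreeLE t A then 1 else 0 := by
  set M := AEval' (Matrix.toLin' (A : Matrix (Fin n) (Fin n) F))
  have hM : Nat.card M = Nat.card F ^ n := by
    have e : (Fin n → F) ≃ₗ[F] M := AEval'.of _
    rw [← Nat.card_congr e.toEquiv, Nat.card_fun, Nat.card_fin]
  have : Finite M := Nat.finite_of_card_ne_zero (hM ▸ pow_ne_zero _ Nat.card_pos.ne')
  have key (φ : smallIrred F t) : ∃ r : ℕ,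
      Nat.card (Submodule.torsionBy F[X] M φ.1) = (Nat.card F ^ φ.1.natDegree) ^ r ∧
      ∀ j : ℕ, (Nat.card {f : (Fin j → F[X] ⧸ Ideal.span {φ.1}) →ₗ[F[X]] M //
        Function.Injective f} : ℝ) =
        ∏ i ∈ Finset.range j, (((Nat.card F : ℝ) ^ φ.1.natDegree) ^ r -
          ((Nat.card F : ℝ) ^ φ.1.natDegree) ^ i) := by
    have : (Ideal.span {φ.1}).IsMaximal :=
      PrincipalIdealRing.isMaximal_of_irreducible φ.2.2.1
    have : Finite (F[X] ⧸ Ideal.span {φ.1}) := by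
      refine Nat.finite_of_card_ne_zero ?_
      rw [natCard_polynomial_quotient]
      exact pow_ne_zero _ Nat.card_pos.ne'
    have := exists_card_torsionBy_eq_pow (M := M) φ.1
    rw [natCard_polynomial_quotient] at this
    simpa only [Nat.cast_pow] using this
  choose r hr hcard using key
  -- This bound makes the cutoff `j φ ≤ n` long enough for the finite identity to be exact.
  have hrn (φ : smallIrred F t) : r φ ≤ n := by
    have h1 : Nat.card (Submodule.torsionBy F[X] M φ.1) ≤ Nat.card M :=
      Nat.card_le_card_of_injective _ Subtype.val_injective
    rw [hr, hM, ← pow_mul] at h1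
    exact (Nat.le_mul_of_pos_left _ φ.2.2.1.natDegree_pos).trans
      ((Nat.pow_le_pow_iff_right Finite.one_lt_card).1 h1)
  have hprod (j : smallIrred F t → ℕ) : (numEmbeddings A j : ℝ) = ∏ φ, ∏ i ∈ Finset.range (j φ),
      (((Nat.card F : ℝ) ^ φ.1.natDegree) ^ r φ - ((Nat.card F : ℝ) ^ φ.1.natDegree) ^ i) := by
    rw [numEmbeddings, card_injective_pi_eq_prod pairwise_isCoprime_smallIrred
      fun φ x => smul_quotient_span_singleton_pi φ.1 x, Nat.cast_prod]
    exact Finset.prod_congr rfl fun φ _ => hcard φ (j φ)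
  have hQ (φ : smallIrred F t) : 1 < (Nat.card F : ℝ) ^ φ.1.natDegree := by
    exact_mod_cast one_lt_card_pow φ
  simp_rw [hprod, ← Finset.prod_mul_distrib]
  rw [sum_piFinset_range_prod fun (φ : smallIrred F t) k =>
    eulerCoeff ((Nat.card F : ℝ) ^ φ.1.natDegree) k * ∏ i ∈ Finset.range k,
      (((Nat.card F : ℝ) ^ φ.1.natDegree) ^ r φ - ((Nat.card F : ℝ) ^ φ.1.natDegree) ^ i)]
  simp_rw [fun φ => sum_eulerCoeff_mul_prod_pow (hQ φ) (hrn φ)]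
  have hiff (φ : smallIrred F t) : r φ = 0 ↔ Submodule.torsionBy F[X] M φ.1 = ⊥ := by
    rw [← Submodule.subsingleton_iff_eq_bot, ← Finite.card_le_one_iff_subsingleton, hr]
    constructor
    · intro h
      rw [h, pow_zero]
    · intro h
      by_contra h0
      exact (Nat.one_lt_pow h0 (one_lt_card_pow φ)).not_ge h
  split_ifs with h
  · rw [noFactorOfDegreeLE_iff] at h
    exact Finset.prod_eq_one fun φ _ => if_pos ((hiff φ).2 (h φ.1 φ.2))
  · rw [noFactorOfDegreeLE_iff] at h
    push Not at h
    obtain ⟨φ, hφ, hne⟩ := h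
    exact Finset.prod_eq_zero (Finset.mem_univ ⟨φ, hφ⟩) (if_neg fun h0 => hne ((hiff ⟨φ, hφ⟩).1 h0))

end Factors

/-! ### Averages over cosets and the limit -/

section Proportion

open Module Polynomial

variable {F : Type*} [Field F] {t : ℕ}

instance [Finite F] (j : smallIrred F t → ℕ) : Module.Finite F (PiQuotient j) :=
  have (φ : smallIrred F t) : Module.Finite F (F[X] ⧸ Ideal.span {φ.1}) :=
    finite_polynomial_quotient φ
  inferInstance

/-- A nonzero constant term makes `X` invertible modulo `φ`. The averaging argument needs this
injectivity. -/
theorem injective_X_smul_piQuotient (j : smallIrred F t → ℕ) :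
    Function.Injective ((LinearMap.lsmul F[X] (PiQuotient j) X).restrictScalars F) := by
  rw [injective_iff_map_eq_zero]
  intro x hx
  have hx : (X : F[X]) • x = 0 := hx
  funext φ
  obtain ⟨u, v, huv⟩ : IsCoprime X φ.1 :=
    irreducible_X.coprime_iff_not_dvd.2 fun h => φ.2.2.2.2 (X_dvd_iff.1 h)
  have h1 : (X : F[X]) • x φ = 0 := congrFun hx φ
  rw [← one_smul F[X] (x φ), ← huv, add_smul, mul_smul, mul_smul, h1,
    smul_quotient_span_singleton_pi, smul_zero, smul_zero, add_zero]
  rfl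

theorem exists_linearMap_injective_of_finrank_le {U : Type*} [AddCommGroup U] [Module F U]
    [Module.Finite F U] {n : ℕ} (h : finrank F U ≤ n) :
    ∃ f : U →ₗ[F] (Fin n → F), Function.Injective f := by
  refine ⟨Function.ExtendByZero.linearMap F (Fin.castLE h) ∘ₗ
    (finBasis F U).equivFun.toLinearMap, ?_⟩
  rw [LinearMap.coe_comp]
  refine Function.Injective.comp (fun x y hxy => ?_) (finBasis F U).equivFun.injective
  funext i
  have hi : Function.extend (Fin.castLE h) x 0 (Fin.castLE h i) =
      Function.extend (Fin.castLE h) y 0 (Fin.castLE h i) := congrFun hxy (Fin.castLE h i)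
  rwa [(Fin.castLE_injective h).extend_apply, (Fin.castLE_injective h).extend_apply] at hi

theorem limitFactor_succ_eq (j i : ℕ) :
    limitFactor F j (i + 1) =
      (1 - 1 / ((Nat.card F : ℝ) ^ j) ^ (i + 1)) ^ numIrred F j := by
  rw [limitFactor, ← pow_mul, mul_comm]

variable [Finite F]

open Classical in
theorem sum_numEmbeddings {n : ℕ} (C : Set (GL (Fin n) F)) (j : smallIrred F t → ℕ) :
    ∑ A ∈ C.toFinite.toFinset, numEmbeddings A j =
      Nat.card {p : (PiQuotient j →ₗ[F] (Fin n → F)) × GL (Fin n) F //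
        p.2 ∈ C ∧ Function.Injective p.1 ∧ glComp p.2 p.1 =
          p.1 ∘ₗ (LinearMap.lsmul F[X] (PiQuotient j) X).restrictScalars F} := by
  have := Fintype.ofFinite C
  have : Finite (PiQuotient j) := Module.finite_of_finite F
  have : Finite (PiQuotient j →ₗ[F] (Fin n → F)) := DFunLike.finite _
  have h1 : ∑ A ∈ C.toFinite.toFinset, numEmbeddings A j = ∑ A : C, numEmbeddings A.1 j :=
    Finset.sum_subtype _ (fun A => C.toFinite.mem_toFinset) _
  rw [h1]
  simp_rw [numEmbeddings, card_injective_aeval']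
  rw [← Nat.card_sigma]
  exact Nat.card_congr
    { toFun := fun p => ⟨(p.2.1, p.1.1), p.1.2, p.2.2⟩
      invFun := fun p => ⟨⟨p.1.2, p.2.1⟩, ⟨p.1.1, p.2.2⟩⟩
      left_inv := fun _ => rfl
      right_inv := fun _ => rfl }

/-- Enlarge `C` to all of `GL_n`, which is transitive on injections whatever the dimension. The
bound is therefore uniform in `j`, as domination requires. -/
theorem sum_numEmbeddings_le {n : ℕ} (C : Set (GL (Fin n) F)) (j : smallIrred F t → ℕ) :
    ∑ A ∈ C.toFinite.toFinset, numEmbeddings A j ≤ Nat.card (GL (Fin n) F) := by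
  calc ∑ A ∈ C.toFinite.toFinset, numEmbeddings A j
      ≤ ∑ A ∈ (Set.univ : Set (GL (Fin n) F)).toFinite.toFinset, numEmbeddings A j :=
        Finset.sum_le_sum_of_subset (by simp)
    _ ≤ Nat.card (GL (Fin n) F) := by
        rw [sum_numEmbeddings]
        by_cases h : ∃ f : PiQuotient j →ₗ[F] (Fin n → F), Function.Injective f
        · obtain ⟨f₀, hf₀⟩ := h
          rw [card_intertwining_pairs_eq (H := ⊤) (fun _ _ _ _ => Set.mem_univ _)
            (fun f g hf hg => (exists_glComp_eq hf hg).imp fun _ h => ⟨Subgroup.mem_top _, h⟩)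
            (injective_X_smul_piQuotient j) hf₀, Set.ncard_univ]
        · rw [@Nat.card_of_isEmpty _ ⟨fun p => h ⟨_, p.2.2.1⟩⟩]
          exact Nat.zero_le _

theorem sum_numEmbeddings_eq_ncard {n : ℕ} {C : Set (GL (Fin n) F)}
    (hC : ∀ B ∈ slSubgroup n F, ∀ A ∈ C, B * A ∈ C) {j : smallIrred F t → ℕ}
    (hj : finrank F (PiQuotient j) < n) :
    ∑ A ∈ C.toFinite.toFinset, numEmbeddings A j = C.ncard := by
  obtain ⟨f₀, hf₀⟩ := exists_linearMap_injective_of_finrank_le hj.le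
  rw [sum_numEmbeddings, card_intertwining_pairs_eq hC
    (fun f g => exists_mem_slSubgroup_glComp_eq hj) (injective_X_smul_piQuotient j) hf₀]

open Classical in
theorem proportion_eq_sum {n : ℕ} (C : Set (GL (Fin n) F)) :
    proportion t C = ∑ j ∈ Fintype.piFinset fun _ : smallIrred F t => Finset.range (n + 1),
      (∏ φ, eulerCoeff ((Nat.card F : ℝ) ^ φ.1.natDegree) (j φ)) *
        (((∑ A ∈ C.toFinite.toFinset, numEmbeddings A j : ℕ) : ℝ) / C.ncard) := by
  have h1 : ({A ∈ C | NoFactorOfDegreeLE t A}.ncard : ℝ) =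
      ∑ A ∈ C.toFinite.toFinset, if NoFactorOfDegreeLE t A then (1 : ℝ) else 0 := by
    rw [Finset.sum_boole, ← Set.ncard_coe_finset]
    congr 2
    ext A
    simp
  rw [proportion, h1]
  simp_rw [← mul_div_assoc, ← Finset.sum_div, ← sum_eulerCoeff_mul_numEmbeddings]
  rw [Finset.sum_comm]
  simp_rw [Nat.cast_sum, Finset.mul_sum]

/-- Only left `SL_n`-invariance matters, so cosets and the whole group are treated together. The
weights are the average embedding counts: at most `q - 1`, and equal to 1 once `n` exceeds the
dimension of the source. -/
theorem tendsto_proportion {C : (n : ℕ) → Set (GL (Fin n) F)} (hne : ∀ n, (C n).Nonempty)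
    (hC : ∀ n, ∀ B ∈ slSubgroup n F, ∀ A ∈ C n, B * A ∈ C n) :
    Tendsto (fun n => proportion t (C n)) atTop
      (𝓝 (∏ φ : smallIrred F t, ∑' k, eulerCoeff ((Nat.card F : ℝ) ^ φ.1.natDegree) k)) := by
  classical
  have hpos (n : ℕ) : (0 : ℝ) < (C n).ncard := by
    exact_mod_cast (Set.ncard_pos (C n).toFinite).2 (hne n)
  simp_rw [proportion_eq_sum]
  refine tendsto_sum_piFinset_mul (B := Nat.card Fˣ)
    (w := fun n j => ((∑ A ∈ (C n).toFinite.toFinset, numEmbeddings A j : ℕ) : ℝ) / (C n).ncard)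
    (c := fun (φ : smallIrred F t) k => eulerCoeff ((Nat.card F : ℝ) ^ φ.1.natDegree) k)
    (fun φ => summable_norm_eulerCoeff (by exact_mod_cast one_lt_card_pow φ))
    (fun n j => ?_) (fun j => ?_)
  · rw [Real.norm_of_nonneg (by positivity), div_le_iff₀ (hpos n)]
    exact_mod_cast (sum_numEmbeddings_le (C n) j).trans (ncard_gl_le (hne n) (hC n))
  · filter_upwards [eventually_gt_atTop (finrank F (PiQuotient j))] with n hn
    rw [sum_numEmbeddings_eq_ncard (hC n) hn, div_self (hpos n).ne']

theorem one_lt_natCard_pow {j : ℕ} (hj : j ≠ 0) : 1 < (Nat.card F : ℝ) ^ j :=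
  one_lt_pow₀ (by exact_mod_cast Finite.one_lt_card) hj

/-- The factor of `φ` depends only on its degree, so grouping by degree produces the exponents
`numIrred F j`. -/
theorem limitProduct_eq :
    limitProduct F t =
      ∏ φ : smallIrred F t, ∑' k, eulerCoeff ((Nat.card F : ℝ) ^ φ.1.natDegree) k := by
  classical
  have hmaps : ∀ φ ∈ (Finset.univ : Finset (smallIrred F t)),
      φ.1.natDegree ∈ Finset.Icc 1 t := fun φ _ =>
    Finset.mem_Icc.2 ⟨φ.2.2.1.natDegree_pos, φ.2.2.2.1⟩
  rw [← Finset.prod_fiberwise_of_maps_to hmaps, limitProduct]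
  refine Finset.prod_congr rfl fun j hj => ?_
  obtain ⟨hj1, hjt⟩ := Finset.mem_Icc.1 hj
  have hQ : 1 < (Nat.card F : ℝ) ^ j := one_lt_natCard_pow (by lia)
  have hcard : (Finset.univ.filter fun φ : smallIrred F t => φ.1.natDegree = j).card =
      numIrred F j := by
    rw [numIrred, ← Set.ncard_coe_finset, ← Set.ncard_image_of_injective _ Subtype.val_injective]
    congr 1
    ext φ
    simp only [Finset.coe_filter, Finset.mem_univ, true_and, Set.mem_image, Set.mem_ofPred_eq,
      Subtype.exists, exists_and_left, exists_prop, exists_eq_right_right]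
    constructor
    · rintro ⟨h1, h2, h3, -, h4⟩
      exact ⟨h2, h3, h1, h4⟩
    · rintro ⟨h1, h2, h3, h4⟩
      exact ⟨h3, h1, h2, h3.trans_le hjt, h4⟩
  rw [Finset.prod_congr rfl fun φ hφ => by rw [(Finset.mem_filter.1 hφ).2], Finset.prod_const,
    hcard, tsum_eulerCoeff hQ, ← (multipliable_one_sub_inv_pow hQ).tprod_pow]
  exact tprod_congr fun i => limitFactor_succ_eq j i

end Proportion

theorem mainTheorem4 (F : Type*) [Field F] [Finite F] (t : ℕ) (ht : 1 ≤ t) :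
    (∀ j ∈ Finset.Icc 1 t, Multipliable fun i : ℕ => limitFactor F j (i + 1)) ∧
    (∀ g : (n : ℕ) → GL (Fin n) F,
      Tendsto (fun n : ℕ => proportion t (g n • (slSubgroup n F : Set (GL (Fin n) F))))
        atTop (𝓝 (limitProduct F t))) ∧
    Tendsto (fun n : ℕ => proportion t (Set.univ : Set (GL (Fin n) F)))
      atTop (𝓝 (limitProduct F t)) := by
  rw [limitProduct_eq]
  refine ⟨fun j hj => ?_, fun g => tendsto_proportion (fun n => ?_) (fun n B hB A hA => ?_),
    tendsto_proportion (fun n => Set.univ_nonempty) fun _ _ _ _ _ => Set.mem_univ _⟩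
  · simp_rw [limitFactor_succ_eq]
    exact (multipliable_one_sub_inv_pow
      (one_lt_natCard_pow (Nat.one_le_iff_ne_zero.1 (Finset.mem_Icc.1 hj).1))).pow _
  · exact ⟨g n, Set.mem_smul_set.2 ⟨1, one_mem _, mul_one _⟩⟩
  -- Left cosets are stable under left multiplication because `SL_n` is the kernel of the
  -- determinant.
  · rw [Set.mem_smul_set_iff_inv_smul_mem, SetLike.mem_coe, smul_eq_mul] at hA ⊢
    rw [slSubgroup_eq_ker_det, MonoidHom.mem_ker] at hA hB ⊢
    rw [map_mul, map_mul, hB, one_mul, ← map_mul, hA]
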